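/- Let $b_0,b_1>0$ and let $\mathcal X=L^2(0,1)\times\mathbb R^2$ (real Hilbert space, $\|(u,v)\|^2=\|u\|_{L^2(0,1)}^2+|v|^2$). Let $\mathbb A$ be the unbounded operator on $\mathcal X$ with domain $$D(\mathbb A)=\{(u,v)\in H^2(0,1)\times\mathbb R^2 : v=(u(0),u(1))\}$$ given by $$\mathbb A\begin{pmatrix}u\\ v\end{pmatrix}=\begin{pmatrix}u''\\ Cu+Bv\end{pmatrix},\qquad Cu=\begin{pmatrix}u'(0)\\ -u'(1)\end{pmatrix},\qquad B=\begin{pmatrix}-b_0&0\\0&-b_1\end{pmatrix}.$$ Then $\mathbb A$ is the infinitesimal generator of a unique strongly continuous semigroup $(e^{t\mathbb A})_{t\ge 0}$ of bounded linear operators on $\mathcal X$, and for every $t>0$ the operator $e^{t\mathbb A}$ is Hilbert–Schmidt, that is, $$\sum_{i}\|e^{t\mathbb A}\phi_i\|_{\mathcal X}^2<\infty$$ for every orthonormal basis $(\phi_i)$ of $\mathcal X$. -/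

import Mathlib

open MeasureTheory Set Filter Topology
open scoped NNReal ContDiff

noncomputable section

/-! ### Strongly continuous semigroups, generators, Hilbert-Schmidt operators -/

/-- `T` is a strongly continuous semigroup of bounded linear operators on `E`. -/
structure IsC0Semigroup {E : Type*} [NormedAddCommGroup E] [NormedSpace ℝ E]
    (T : ℝ≥0 → E →L[ℝ] E) : Prop where
  zero : T 0 = ContinuousLinearMap.id ℝ E
  add : ∀ s t : ℝ≥0, T (s + t) = (T s).comp (T t)
  tendsto_zero : ∀ x : E, Tendsto (fun t : ℝ≥0 => T t x) (𝓝 0) (𝓝 x)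

/-- `A` is the infinitesimal generator of `T`: `x` lies in the domain of `A` and `A x = y` if and
only if `(T t x - x) / t` converges to `y` as `t` decreases to `0`. In particular the domain of `A`
is the set of all `x` for which this limit exists. -/
def IsGeneratorOf {E : Type*} [NormedAddCommGroup E] [NormedSpace ℝ E]
    (A : E →ₗ.[ℝ] E) (T : ℝ≥0 → E →L[ℝ] E) : Prop :=
  ∀ x y : E, (x, y) ∈ A.graph ↔
    Tendsto (fun t : ℝ≥0 => (t : ℝ)⁻¹ • (T t x - x)) (𝓝[>] 0) (𝓝 y)

/-- `S` is Hilbert-Schmidt: `∑ ‖S φᵢ‖² < ∞` for every orthonormal basis `φ` (with any index type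
in the universe of `H`, which is enough for every orthonormal basis of `H`). -/
def IsHilbertSchmidt.{u} {H : Type u} [NormedAddCommGroup H] [InnerProductSpace ℝ H]
    (S : H →L[ℝ] H) : Prop :=
  ∀ (ι : Type u) (φ : HilbertBasis ι ℝ H), Summable fun i => ‖S (φ i)‖ ^ 2

/-! ### The spaces -/

/-- Lebesgue measure on the open unit interval. -/
abbrev unitMeasure : Measure ℝ := volume.restrict (Ioo (0 : ℝ) 1)

/-- The real Hilbert space `L²(0,1)`. -/
abbrev L2Unit : Type := Lp ℝ 2 unitMeasure

/-- The real Hilbert space `L²(0,1) × ℝ²`, with `‖(u, v)‖² = ‖u‖² + |v|²`. -/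
abbrev StateSpace : Type := WithLp 2 (L2Unit × EuclideanSpace ℝ (Fin 2))

/-- `φ` is a test function on `(0,1)`, an element of `C_c^∞(0,1)`. -/
def IsTestFunction (φ : ℝ → ℝ) : Prop :=
  ContDiff ℝ ∞ φ ∧ HasCompactSupport φ ∧ tsupport φ ⊆ Ioo (0 : ℝ) 1

/-- `g ∈ L²(0,1)` is the weak derivative of `u ∈ L²(0,1)`. Hence `H¹(0,1)` is the set of all `u`
with `∃ g, HasWeakDeriv u g`, and `H²(0,1)` is the set of all `u` with
`∃ g h, HasWeakDeriv u g ∧ HasWeakDeriv g h`. -/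
def HasWeakDeriv (u g : L2Unit) : Prop :=
  ∀ φ : ℝ → ℝ, IsTestFunction φ →
    ∫ x, u x * deriv φ x ∂unitMeasure = -∫ x, g x * φ x ∂unitMeasure

/-- `α = (u(0), u(1))`: the class `u` has a representative that is continuous on `[0,1]`, with
boundary values `α 0` at `0` and `α 1` at `1`. Every `u ∈ H¹(0,1)` has exactly one such `α`. -/
def HasBoundaryValues (u : L2Unit) (α : EuclideanSpace ℝ (Fin 2)) : Prop :=
  ∃ f : ℝ → ℝ, ContinuousOn f (Icc 0 1) ∧ u =ᵐ[unitMeasure] f ∧ f 0 = α 0 ∧ f 1 = α 1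

/-! ### Facts that make the operator well defined -/

lemma integrable_mul_of_continuous_compactSupport (u : L2Unit) {ψ : ℝ → ℝ} (hψ : Continuous ψ)
    (hc : HasCompactSupport ψ) : Integrable (fun x => u x * ψ x) unitMeasure := by
  obtain ⟨C, hC⟩ := hc.exists_bound_of_continuous hψ
  have hu : Integrable (fun x => u x) unitMeasure := (Lp.memLp u).integrable (by norm_num)
  exact hu.mul_bdd hψ.aestronglyMeasurable (Eventually.of_forall hC)

lemma IsTestFunction.integrable_mul {φ : ℝ → ℝ} (hφ : IsTestFunction φ) (u : L2Unit) :
    Integrable (fun x => u x * φ x) unitMeasure :=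
  integrable_mul_of_continuous_compactSupport u hφ.1.continuous hφ.2.1

lemma IsTestFunction.integrable_mul_deriv {φ : ℝ → ℝ} (hφ : IsTestFunction φ) (u : L2Unit) :
    Integrable (fun x => u x * deriv φ x) unitMeasure :=
  integrable_mul_of_continuous_compactSupport u (hφ.1.continuous_deriv (by simp)) hφ.2.1.deriv

lemma HasWeakDeriv.add {u g v h : L2Unit} (hu : HasWeakDeriv u g) (hv : HasWeakDeriv v h) :
    HasWeakDeriv (u + v) (g + h) := by
  intro φ hφ
  have e1 : ∫ x, (u + v : L2Unit) x * deriv φ x ∂unitMeasure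
      = ∫ x, (u x * deriv φ x + v x * deriv φ x) ∂unitMeasure := by
    refine integral_congr_ae ?_
    filter_upwards [Lp.coeFn_add u v] with x hx
    rw [hx, Pi.add_apply, add_mul]
  have e2 : ∫ x, (g + h : L2Unit) x * φ x ∂unitMeasure
      = ∫ x, (g x * φ x + h x * φ x) ∂unitMeasure := by
    refine integral_congr_ae ?_
    filter_upwards [Lp.coeFn_add g h] with x hx
    rw [hx, Pi.add_apply, add_mul]
  rw [e1, e2, integral_add (hφ.integrable_mul_deriv u) (hφ.integrable_mul_deriv v),
    integral_add (hφ.integrable_mul g) (hφ.integrable_mul h), hu φ hφ, hv φ hφ, neg_add]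

lemma HasWeakDeriv.smul {u g : L2Unit} (c : ℝ) (hu : HasWeakDeriv u g) :
    HasWeakDeriv (c • u) (c • g) := by
  intro φ hφ
  have e1 : ∫ x, (c • u : L2Unit) x * deriv φ x ∂unitMeasure
      = ∫ x, c * (u x * deriv φ x) ∂unitMeasure := by
    refine integral_congr_ae ?_
    filter_upwards [Lp.coeFn_smul c u] with x hx
    rw [hx, Pi.smul_apply, smul_eq_mul, mul_assoc]
  have e2 : ∫ x, (c • g : L2Unit) x * φ x ∂unitMeasure = ∫ x, c * (g x * φ x) ∂unitMeasure := by
    refine integral_congr_ae ?_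
    filter_upwards [Lp.coeFn_smul c g] with x hx
    rw [hx, Pi.smul_apply, smul_eq_mul, mul_assoc]
  rw [e1, e2, integral_const_mul, integral_const_mul, hu φ hφ, mul_neg]

lemma HasWeakDeriv.zero : HasWeakDeriv 0 0 := by
  have e (ψ : ℝ → ℝ) : ∫ x, (0 : L2Unit) x * ψ x ∂unitMeasure = 0 := by
    refine (integral_congr_ae ?_).trans (integral_zero ℝ ℝ)
    filter_upwards [Lp.coeFn_zero ℝ 2 unitMeasure] with x hx
    rw [hx, Pi.zero_apply, zero_mul]
  intro φ _
  rw [e, e, neg_zero]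

lemma HasWeakDeriv.eq_zero {g : L2Unit} (hg : HasWeakDeriv 0 g) : g = 0 := by
  have hgi : IntegrableOn (fun x => g x) (Ioo (0 : ℝ) 1) volume :=
    (Lp.memLp g).integrable (by norm_num)
  have key := isOpen_Ioo.ae_eq_zero_of_integral_contDiff_smul_eq_zero (μ := volume)
    (U := Ioo (0 : ℝ) 1) (f := fun x => g x) hgi.locallyIntegrableOn ?_
  · rw [Lp.eq_zero_iff_ae_eq_zero]
    exact (ae_restrict_iff' measurableSet_Ioo).2 key
  · intro φ h1 h2 h3
    have h := hg φ ⟨h1, h2, h3⟩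
    have e : ∫ x, (0 : L2Unit) x * deriv φ x ∂unitMeasure = 0 := by
      refine (integral_congr_ae ?_).trans (integral_zero ℝ ℝ)
      filter_upwards [Lp.coeFn_zero ℝ 2 unitMeasure] with x hx
      rw [hx, Pi.zero_apply, zero_mul]
    rw [e, zero_eq_neg] at h
    rw [← h, ← setIntegral_eq_integral_of_forall_compl_eq_zero (s := Ioo (0 : ℝ) 1)]
    · exact integral_congr_ae (Eventually.of_forall fun x => by simp [mul_comm])
    · intro x hx
      rw [image_eq_zero_of_notMem_tsupport (fun hx' => hx (h3 hx')), zero_smul]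

lemma HasBoundaryValues.add {u v : L2Unit} {α β : EuclideanSpace ℝ (Fin 2)}
    (hu : HasBoundaryValues u α) (hv : HasBoundaryValues v β) :
    HasBoundaryValues (u + v) (α + β) := by
  obtain ⟨f, hf, hfu, hf0, hf1⟩ := hu
  obtain ⟨k, hk, hkv, hk0, hk1⟩ := hv
  refine ⟨f + k, hf.add hk, (Lp.coeFn_add u v).trans (hfu.add hkv), ?_, ?_⟩
  · simp [hf0, hk0]
  · simp [hf1, hk1]

lemma HasBoundaryValues.smul {u : L2Unit} {α : EuclideanSpace ℝ (Fin 2)} (c : ℝ)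
    (hu : HasBoundaryValues u α) : HasBoundaryValues (c • u) (c • α) := by
  obtain ⟨f, hf, hfu, hf0, hf1⟩ := hu
  refine ⟨c • f, hf.const_smul c, (Lp.coeFn_smul c u).trans (hfu.const_smul c), ?_, ?_⟩
  · simp [hf0]
  · simp [hf1]

lemma HasBoundaryValues.zero : HasBoundaryValues 0 0 :=
  ⟨0, continuousOn_const, Lp.coeFn_zero ℝ 2 unitMeasure, by simp, by simp⟩

lemma HasBoundaryValues.eq_zero {α : EuclideanSpace ℝ (Fin 2)} (h : HasBoundaryValues 0 α) :
    α = 0 := by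
  obtain ⟨f, hf, hf0, h0, h1⟩ := h
  have hz : f =ᵐ[volume.restrict (Icc (0 : ℝ) 1)] 0 := by
    rw [← restrict_Ioo_eq_restrict_Icc]
    exact hf0.symm.trans (Lp.coeFn_zero ℝ 2 unitMeasure)
  have hE := Measure.eqOn_Icc_of_ae_eq (μ := volume) (zero_ne_one' ℝ) hz hf continuousOn_const
  ext i
  fin_cases i
  · simpa [← h0] using hE (left_mem_Icc.2 zero_le_one)
  · simpa [← h1] using hE (right_mem_Icc.2 zero_le_one)

/-! ### The operator -/

/-- The graph of the matrix operator `𝔸 = (A_m, 0; C, B)`. The pair `(U, W)`, where `U = (u, v)`,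
belongs to it if and only if `u ∈ H²(0,1)` (with weak derivatives `g = u'` and `u''`),
`v = (u(0), u(1))`, and `W = (u'', C u + B v)` where `C u = (u'(0), -u'(1))` and
`B = diag(-b₀, -b₁)`. The boundary values `c = (u'(0), u'(1))` exist because `u' ∈ H¹(0,1)`. -/
def matrixOpGraph (b₀ b₁ : ℝ) : Submodule ℝ (StateSpace × StateSpace) where
  carrier := {p | HasBoundaryValues p.1.fst p.1.snd ∧
    ∃ (g : L2Unit) (c : EuclideanSpace ℝ (Fin 2)),
      HasWeakDeriv p.1.fst g ∧ HasWeakDeriv g p.2.fst ∧ HasBoundaryValues g c ∧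
      p.2.snd 0 = c 0 + (-b₀) * p.1.snd 0 ∧ p.2.snd 1 = -c 1 + (-b₁) * p.1.snd 1}
  add_mem' := by
    rintro p q ⟨hp, g, c, h1, h2, h3, h4, h5⟩ ⟨hq, g', c', k1, k2, k3, k4, k5⟩
    refine ⟨hp.add hq, g + g', c + c', h1.add k1, h2.add k2, h3.add k3, ?_, ?_⟩
    · simp [h4, k4]; ring
    · simp [h5, k5]; ring
  zero_mem' := ⟨HasBoundaryValues.zero, 0, 0, HasWeakDeriv.zero, HasWeakDeriv.zero,
    HasBoundaryValues.zero, by simp, by simp⟩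
  smul_mem' := by
    rintro a p ⟨hp, g, c, h1, h2, h3, h4, h5⟩
    refine ⟨hp.smul a, a • g, a • c, h1.smul a, h2.smul a, h3.smul a, ?_, ?_⟩
    · simp [h4]; ring
    · simp [h5]; ring

lemma matrixOpGraph_single_valued (b₀ b₁ : ℝ) (p : StateSpace × StateSpace)
    (hp : p ∈ matrixOpGraph b₀ b₁) (h0 : p.1 = 0) : p.2 = 0 := by
  obtain ⟨U, W⟩ := p
  obtain rfl : U = 0 := h0
  obtain ⟨-, g, c, h1, h2, h3, h4, h5⟩ := hp
  obtain rfl : g = 0 := HasWeakDeriv.eq_zero h1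
  obtain rfl : c = 0 := h3.eq_zero
  have hf : W.fst = 0 := HasWeakDeriv.eq_zero h2
  have hs : W.snd = 0 := by
    ext i
    fin_cases i
    · simpa using h4
    · simpa using h5
  exact WithLp.ofLp_injective 2 (Prod.ext hf hs)

/-- The unbounded operator `𝔸 (u, v) = (u'', C u + B v)` on `L²(0,1) × ℝ²` with domain
`{(u, v) | u ∈ H²(0,1), v = (u(0), u(1))}`. -/
def matrixOp (b₀ b₁ : ℝ) : StateSpace →ₗ.[ℝ] StateSpace :=
  (matrixOpGraph b₀ b₁).toLinearPMap

/-- The junk branch in `Submodule.toLinearPMap` is not used. -/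
lemma matrixOp_graph (b₀ b₁ : ℝ) : (matrixOp b₀ b₁).graph = matrixOpGraph b₀ b₁ :=
  Submodule.toLinearPMap_graph_eq _ (matrixOpGraph_single_valued b₀ b₁)

end

-- The equation `𝔸 U = W` can be solved explicitly: integrate `u'' = f` twice and determine `u(0)`
-- and `u'(0)` from the two boundary equations, a linear system that is invertible because `b₀, b₁ >
-- 0`. So `-𝔸` has a bounded inverse `K`, which is `negInverse`. Integration by parts gives `⟨W, K
-- Z⟩ = ⟨u_W', u_Z'⟩ + b₀ u_W(0) u_Z(0) + b₁ u_W(1) u_Z(1)` (`inner_negInverse`), hence `K` is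
-- symmetric and nonnegative. It is Hilbert–Schmidt because the evaluations `W ↦ u_W(x)` are bounded
-- uniformly in `x`: apply Bessel to each and integrate over `x`.
--
-- The rest is abstract (`existsUnique_semigroup_of_hilbertSchmidt_inverse`). `K` is compact, so it
-- has a Hilbert basis of eigenvectors with eigenvalues `μᵢ > 0` and `∑ μᵢ² < ∞`. The semigroup is
-- diagonal with entries `exp (-t / μᵢ)`. It is the only one, since every semigroup acts as an
-- exponential on eigenvectors of its generator. Finally `exp (-t / μᵢ) ≤ μᵢ / t` makes these
-- entries square summable for `t > 0`.

universe u

/-! ### Hilbert bases, compact operators and diagonal operators -/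

theorem HilbertBasis.ext_continuousLinearMap {ι H F : Type*} [NormedAddCommGroup H]
    [InnerProductSpace ℝ H] [NormedAddCommGroup F] [NormedSpace ℝ F] (φ : HilbertBasis ι ℝ H)
    {S T : H →L[ℝ] F} (h : ∀ i, S (φ i) = T (φ i)) : S = T := by
  refine ContinuousLinearMap.ext_on
    (Submodule.dense_iff_topologicalClosure_eq_top.2 φ.dense_span) ?_
  rintro _ ⟨i, rfl⟩
  exact h i

theorem HilbertBasis.hasSum_sq_inner {ι H : Type*} [NormedAddCommGroup H]
    [InnerProductSpace ℝ H] (φ : HilbertBasis ι ℝ H) (x : H) :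
    HasSum (fun i => inner ℝ (φ i) x ^ 2) (‖x‖ ^ 2) := by
  have h := φ.hasSum_inner_mul_inner x x
  rw [real_inner_self_eq_norm_sq] at h
  refine h.congr_fun fun i => ?_
  rw [real_inner_comm, sq]

/-- An operator that is square summable along one Hilbert basis is compact. -/
theorem isCompactOperator_of_summable_sq {ι H : Type*} [NormedAddCommGroup H]
    [InnerProductSpace ℝ H] [CompleteSpace H] (φ : HilbertBasis ι ℝ H) (K : H →L[ℝ] H)
    (hK : Summable fun i => ‖K (φ i)‖ ^ 2) : IsCompactOperator K := by
  let R : ι → H →L[ℝ] H := fun i => (innerSL ℝ (φ i)).smulRight (K (φ i))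
  have hR (i : ι) (x : H) : R i x = inner ℝ (φ i) x • K (φ i) := rfl
  -- Cauchy–Schwarz and Bessel bound finite sums of the rank-one pieces `R i` in operator norm.
  -- Hence `∑ R i` converges in norm, and `K` is a norm limit of finite-rank operators.
  have hbound (s : Finset ι) : ‖∑ i ∈ s, R i‖ ≤ √(∑ i ∈ s, ‖K (φ i)‖ ^ 2) := by
    refine ContinuousLinearMap.opNorm_le_bound _ (Real.sqrt_nonneg _) fun x => ?_
    rw [_root_.sum_apply]
    calc ‖∑ i ∈ s, R i x‖ ≤ ∑ i ∈ s, ‖K (φ i)‖ * |inner ℝ (φ i) x| := by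
          refine (norm_sum_le _ _).trans (Finset.sum_le_sum fun i _ => ?_)
          rw [hR, norm_smul, Real.norm_eq_abs, mul_comm]
      _ ≤ √(∑ i ∈ s, ‖K (φ i)‖ ^ 2) * √(∑ i ∈ s, |inner ℝ (φ i) x| ^ 2) :=
          Real.sum_mul_le_sqrt_mul_sqrt _ _ _
      _ ≤ √(∑ i ∈ s, ‖K (φ i)‖ ^ 2) * ‖x‖ := by
          gcongr
          rw [← Real.sqrt_sq (norm_nonneg x)]
          exact Real.sqrt_le_sqrt (φ.orthonormal.sum_inner_products_le x)
  have hsum : Summable R := by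
    rw [summable_iff_vanishing_norm]
    intro ε hε
    obtain ⟨s, hs⟩ := summable_iff_vanishing_norm.1 hK (ε ^ 2) (by positivity)
    refine ⟨s, fun t ht => (hbound t).trans_lt ?_⟩
    rw [Real.sqrt_lt' hε]
    exact (le_abs_self _).trans_lt (hs t ht)
  have hlim : HasSum R K := by
    have : ∑' i, R i = K := by
      refine ContinuousLinearMap.ext fun x => ?_
      refine (hsum.hasSum.mapL (ContinuousLinearMap.apply ℝ H x)).unique ?_
      have h := (φ.hasSum_repr x).mapL K
      refine h.congr_fun fun i => ?_
      simp [hR, φ.repr_apply_apply]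
    exact this ▸ hsum.hasSum
  refine isClosed_setOfPred_isCompactOperator.mem_of_tendsto hlim (Eventually.of_forall fun s => ?_)
  refine Finset.sum_induction R (fun T => IsCompactOperator T) (fun _ _ => IsCompactOperator.add)
    isCompactOperator_zero fun i _ => ?_
  have h1 : IsCompactOperator (id : ℝ → ℝ) :=
    (isCompactOperator_id_iff_finiteDimensional (𝕜 := ℝ)).2 inferInstance
  exact (h1.comp_clm (innerSL ℝ (φ i))).clm_comp (ContinuousLinearMap.toSpanSingleton ℝ (K (φ i)))

/-- A compact symmetric operator has a Hilbert basis of eigenvectors. -/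
theorem exists_hilbertBasis_eigenvectors {H : Type u} [NormedAddCommGroup H]
    [InnerProductSpace ℝ H] [CompleteSpace H] {K : H →L[ℝ] H} (hK : IsCompactOperator K)
    (hs : (K : H →ₗ[ℝ] H).IsSymmetric) :
    ∃ (ι : Type u) (φ : HilbertBasis ι ℝ H) (μ : ι → ℝ), ∀ i, K (φ i) = μ i • φ i := by
  let V : ℝ → Submodule ℝ H := fun μ => Module.End.eigenspace (K : Module.End ℝ H) μ
  have hV (μ : ℝ) : IsClosed (V μ : Set H) := by
    have : (V μ : Set H) = {x | K x = μ • x} := by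
      ext x
      exact Module.End.mem_eigenspace_iff
    rw [this]
    exact isClosed_eq K.continuous (continuous_const_smul μ)
  have hVc (μ : ℝ) : CompleteSpace (V μ) := (hV μ).completeSpace_coe
  choose w b hb using fun μ => exists_hilbertBasis ℝ (V μ)
  let v : (Σ μ, w μ) → H := fun a => (b a.1 a.2 : H)
  have hv : Orthonormal ℝ v :=
    hs.orthogonalFamily_eigenspaces.orthonormal_sigma_orthonormal fun μ => (b μ).orthonormal
  -- A vector orthogonal to all the chosen bases is orthogonal to every eigenspace, so it vanishes
  -- by the spectral theorem for compact symmetric operators.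
  have hspan : (Submodule.span ℝ (Set.range v))ᗮ = ⊥ := by
    rw [eq_bot_iff, ← ContinuousLinearMap.orthogonalComplement_iSup_eigenspaces_eq_bot hK hs]
    intro x hx
    rw [← Submodule.iInf_orthogonal, Submodule.mem_iInf]
    intro μ y hy
    have h0 : (innerSL ℝ x).comp (V μ).subtypeL = 0 := by
      refine (b μ).ext_continuousLinearMap fun i => ?_
      have := hx (v ⟨μ, i⟩) (Submodule.subset_span ⟨_, rfl⟩)
      rw [real_inner_comm] at this
      simpa using this
    rw [real_inner_comm]
    exact DFunLike.congr_fun h0 (⟨y, hy⟩ : V μ)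
  refine ⟨_, HilbertBasis.mkOfOrthogonalEqBot hv hspan, fun a => a.1, fun a => ?_⟩
  rw [HilbertBasis.coe_mkOfOrthogonalEqBot]
  exact Module.End.mem_eigenspace_iff.1 (b a.1 a.2).2

/-- Conjugate coordinatewise multiplication on `ℓ²` by the isometry `φ.repr`. -/
theorem HilbertBasis.exists_diagonal {ι H : Type*} [NormedAddCommGroup H]
    [InnerProductSpace ℝ H] (φ : HilbertBasis ι ℝ H) {m : ι → ℝ} (hm : ∀ i, |m i| ≤ 1) :
    ∃ S : H →L[ℝ] H, ‖S‖ ≤ 1 ∧ ∀ i, S (φ i) = m i • φ i := by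
  classical
  have hn (i : ι) : ‖m i • ContinuousLinearMap.id ℝ ℝ‖ ≤ 1 := by
    rw [norm_smul, ContinuousLinearMap.norm_id, mul_one]
    exact hm i
  let D := lp.mapCLM 2 (fun i => m i • ContinuousLinearMap.id ℝ ℝ) zero_le_one hn
  refine ⟨(φ.repr.symm.toContinuousLinearEquiv : _ →L[ℝ] H).comp
    (D.comp (φ.repr.toContinuousLinearEquiv : H →L[ℝ] _)), ?_, fun i => ?_⟩
  · refine ContinuousLinearMap.opNorm_le_bound _ zero_le_one fun x => ?_
    have h := D.le_of_opNorm_le (lp.norm_mapCLM_le 2 _ zero_le_one hn) (φ.repr x)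
    simpa using h
  · have h : D (lp.single 2 i (1 : ℝ)) = m i • lp.single 2 i (1 : ℝ) := by
      ext j
      by_cases hj : j = i
      · subst hj
        simp [D, lp.mapCLM]
      · simp [D, lp.mapCLM, lp.single_apply, hj]
    have h2 : φ.repr.symm (D (φ.repr (φ i))) = m i • φ i := by
      rw [φ.repr_self, h, map_smul, φ.repr_symm_single]
    exact h2

theorem HilbertBasis.opNorm_le_one_of_diagonal {ι H : Type*} [NormedAddCommGroup H]
    [InnerProductSpace ℝ H] (φ : HilbertBasis ι ℝ H) {m : ι → ℝ} (hm : ∀ i, |m i| ≤ 1)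
    {S : H →L[ℝ] H} (hS : ∀ i, S (φ i) = m i • φ i) : ‖S‖ ≤ 1 := by
  obtain ⟨T, hT, h⟩ := φ.exists_diagonal hm
  rwa [φ.ext_continuousLinearMap fun i => (hS i).trans (h i).symm]

theorem HilbertBasis.inner_diagonal {ι H : Type*} [NormedAddCommGroup H]
    [InnerProductSpace ℝ H] (φ : HilbertBasis ι ℝ H) {m : ι → ℝ}
    {S : H →L[ℝ] H} (hS : ∀ i, S (φ i) = m i • φ i) (i : ι) (x : H) :
    inner ℝ (φ i) (S x) = m i * inner ℝ (φ i) x := by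
  classical
  have h : (innerSL ℝ (φ i)).comp S = m i • innerSL ℝ (φ i) := by
    refine φ.ext_continuousLinearMap fun j => ?_
    by_cases hj : i = j
    · subst hj
      simp [hS]
    · simp [hS, φ.orthonormal.inner_eq_zero hj]
  exact DFunLike.congr_fun h x

/-- Contractions are equicontinuous, so the set of points of convergence is closed; it contains the
dense span of the basis. -/
theorem HilbertBasis.tendsto_of_forall_tendsto {ι α H : Type*} [NormedAddCommGroup H]
    [InnerProductSpace ℝ H] (φ : HilbertBasis ι ℝ H) {l : Filter α} {S : α → H →L[ℝ] H}
    (hS : ∀ a, ‖S a‖ ≤ 1) {S₀ : H →L[ℝ] H}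
    (h : ∀ i, Tendsto (fun a => S a (φ i)) l (𝓝 (S₀ (φ i)))) (x : H) :
    Tendsto (fun a => S a x) l (𝓝 (S₀ x)) := by
  have hlip : UniformEquicontinuous fun a => (S a : H → H) :=
    LipschitzWith.uniformEquicontinuous _ 1 fun a =>
      (S a).lipschitz.weaken (by exact_mod_cast hS a)
  have hc : IsClosed {x | Tendsto (fun a => S a x) l (𝓝 (S₀ x))} :=
    hlip.equicontinuous.isClosed_setOfPred_tendsto S₀.continuous
  have hd : Dense (Submodule.span ℝ (Set.range φ) : Set H) :=
    Submodule.dense_iff_topologicalClosure_eq_top.2 φ.dense_span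
  refine hc.closure_subset_iff.2 ?_ (hd x)
  intro y hy
  induction hy using Submodule.span_induction with
  | mem _ hz =>
    obtain ⟨i, rfl⟩ := hz
    exact h i
  | zero => simpa using tendsto_const_nhds
  | add y z _ _ hy hz => simpa using Tendsto.add hy hz
  | smul c y _ hy => simpa using Tendsto.const_smul hy c

/-- A diagonal operator with square summable diagonal is Hilbert-Schmidt. -/
theorem HilbertBasis.isHilbertSchmidt_diagonal {H : Type u} [NormedAddCommGroup H]
    [InnerProductSpace ℝ H] {ι : Type*} (φ : HilbertBasis ι ℝ H) {m : ι → ℝ}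
    {S : H →L[ℝ] H} (hS : ∀ i, S (φ i) = m i • φ i) (hm : Summable fun i => m i ^ 2) :
    IsHilbertSchmidt S := by
  intro κ ψ
  refine summable_of_sum_le (c := ∑' i, m i ^ 2) (fun _ => by positivity) fun s => ?_
  have h (j : κ) : HasSum (fun i => m i ^ 2 * inner ℝ (φ i) (ψ j) ^ 2) (‖S (ψ j)‖ ^ 2) := by
    refine (φ.hasSum_sq_inner (S (ψ j))).congr_fun fun i => ?_
    rw [φ.inner_diagonal hS, mul_pow]
  refine hasSum_le (fun i => ?_) (hasSum_sum fun j _ => h j) hm.hasSum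
  -- With the two sums interchanged, Bessel for `ψ` at the unit vector `φ i` bounds the coefficient
  -- of `m i ^ 2` by `1`.
  rw [← Finset.mul_sum]
  refine mul_le_of_le_one_right (sq_nonneg _) ?_
  have := ψ.orthonormal.sum_inner_products_le (s := s) (φ i)
  simpa [φ.orthonormal.1 i, real_inner_comm] using this

theorem tendsto_inv_mul_exp_sub_one (c : ℝ) :
    Tendsto (fun t : ℝ≥0 => (t : ℝ)⁻¹ * (Real.exp (c * t) - 1)) (𝓝[>] 0) (𝓝 c) := by
  have h : HasDerivAt (fun t : ℝ => Real.exp (c * t)) c 0 := by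
    simpa using ((hasDerivAt_id (0 : ℝ)).const_mul c).exp
  have h2 := h.tendsto_slope_zero_right
  have h3 : Tendsto (fun t : ℝ≥0 => (t : ℝ)) (𝓝[>] 0) (𝓝[>] 0) := by
    refine tendsto_nhdsWithin_iff.2 ⟨?_, ?_⟩
    · exact (NNReal.continuous_coe.tendsto' 0 0 NNReal.coe_zero).mono_left nhdsWithin_le_nhds
    · filter_upwards [self_mem_nhdsWithin] with t ht
      exact NNReal.coe_pos.2 ht
  simpa [Function.comp_def] using h2.comp h3

/-! ### General strongly continuous semigroups -/

namespace IsC0Semigroup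

variable {E : Type*} [NormedAddCommGroup E] [NormedSpace ℝ E] {T : ℝ≥0 → E →L[ℝ] E}

/-- Otherwise some `t n → 0` has `‖T (t n)‖ > n`; but each orbit `T (t n) x` converges, hence is
bounded, which contradicts Banach–Steinhaus. -/
theorem exists_bound_nhds_zero [CompleteSpace E] (hT : IsC0Semigroup T) :
    ∃ C : ℝ, ∃ δ : ℝ≥0, 0 < δ ∧ ∀ t ≤ δ, ‖T t‖ ≤ C := by
  by_contra! hcon
  have hpos (n : ℕ) : (0 : ℝ≥0) < 1 / ((n : ℝ≥0) + 1) := by positivity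
  choose t ht hn using fun n : ℕ => hcon n _ (hpos n)
  have ht0 : Tendsto t atTop (𝓝 0) :=
    tendsto_of_tendsto_of_tendsto_of_le_of_le tendsto_const_nhds
      tendsto_one_div_add_atTop_nhds_zero_nat (fun _ => zero_le) ht
  obtain ⟨C, hC⟩ := banach_steinhaus (g := fun n => T (t n)) fun x => by
    obtain ⟨C, hC⟩ := ((hT.tendsto_zero x).comp ht0).norm.bddAbove_range
    exact ⟨C, fun n => hC ⟨n, rfl⟩⟩
  obtain ⟨n, hCn⟩ := exists_nat_gt C
  exact absurd (hC n) (not_le.2 (hCn.trans (hn n)))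

theorem exists_bound [CompleteSpace E] (hT : IsC0Semigroup T) (s : ℝ≥0) :
    ∃ C : ℝ, ∀ t ≤ s, ‖T t‖ ≤ C := by
  obtain ⟨C, δ, hδ, hC⟩ := hT.exists_bound_nhds_zero
  have h (n : ℕ) : ∃ D : ℝ, ∀ t ≤ n * δ, ‖T t‖ ≤ D := by
    induction n with
    | zero =>
      refine ⟨‖T 0‖, fun t ht => ?_⟩
      rw [Nat.cast_zero, zero_mul, nonpos_iff_eq_zero] at ht
      rw [ht]
    | succ n ih =>
      obtain ⟨D, hD⟩ := ih
      refine ⟨max D (C * D), fun t ht => ?_⟩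
      rcases le_total t (n * δ) with h | h
      · exact (hD t h).trans (le_max_left _ _)
      · have e : t = (t - n * δ) + n * δ := (tsub_add_cancel_of_le h).symm
        have h1 : t - n * δ ≤ δ := by
          rw [tsub_le_iff_left]
          push_cast at ht
          linarith
        rw [e, hT.add]
        refine (ContinuousLinearMap.opNorm_comp_le _ _).trans (le_trans ?_ (le_max_right _ _))
        exact mul_le_mul (hC _ h1) (hD _ le_rfl) (norm_nonneg _)
          ((norm_nonneg _).trans (hC _ h1))
  obtain ⟨n, hn⟩ := exists_nat_ge (s / δ)
  obtain ⟨D, hD⟩ := h n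
  exact ⟨D, fun t ht => hD t (ht.trans ((div_le_iff₀ hδ).1 hn))⟩

theorem norm_apply_sub_le (hT : IsC0Semigroup T) {C : ℝ} {s : ℝ≥0} (hC : ∀ t ≤ s, ‖T t‖ ≤ C)
    (x : E) {a b : ℝ≥0} (hab : a ≤ b) (hb : b ≤ s) : ‖T b x - T a x‖ ≤ C * ‖T (b - a) x - x‖ := by
  have e : T b x - T a x = T a (T (b - a) x - x) := by
    rw [map_sub, ← ContinuousLinearMap.comp_apply, ← hT.add, add_tsub_cancel_of_le hab]
  rw [e]
  exact (T a).le_of_opNorm_le (hC a (hab.trans hb)) _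

theorem continuous [CompleteSpace E] (hT : IsC0Semigroup T) (x : E) :
    Continuous fun t => T t x := by
  refine continuous_iff_continuousAt.2 fun a => ?_
  obtain ⟨C, hC⟩ := hT.exists_bound (a + 1)
  -- Subtraction in `ℝ≥0` is truncated, so `(b - a) + (a - b)` is `|b - a|` and treats both sides of
  -- `a` at once.
  have hd : Tendsto (fun b => (b - a) + (a - b)) (𝓝 a) (𝓝 0) := by
    have : Continuous fun b : ℝ≥0 => (b - a) + (a - b) := by fun_prop
    exact this.tendsto' _ _ (by simp)
  have h := ((hT.tendsto_zero x).comp hd).sub_const x |>.norm.const_mul C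
  rw [sub_self, norm_zero, mul_zero] at h
  refine tendsto_iff_norm_sub_tendsto_zero.2 (squeeze_zero' ?_ ?_ h)
  · exact Eventually.of_forall fun _ => norm_nonneg _
  · filter_upwards [eventually_lt_nhds (lt_add_one a)] with b hb
    rcases le_total a b with hab | hab
    · simpa [tsub_eq_zero_of_le hab] using hT.norm_apply_sub_le hC x hab hb.le
    · rw [norm_sub_rev]
      simpa [tsub_eq_zero_of_le hab] using
        hT.norm_apply_sub_le hC x hab (le_self_add : a ≤ a + 1)

/-- On an eigenvector of the generator the semigroup is an exponential. -/
theorem apply_eq_exp_smul [CompleteSpace E] (hT : IsC0Semigroup T) {x : E} {c : ℝ}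
    (hx : Tendsto (fun t : ℝ≥0 => (t : ℝ)⁻¹ • (T t x - x)) (𝓝[>] 0) (𝓝 (c • x))) (t : ℝ≥0) :
    T t x = Real.exp (c * t) • x := by
  let g : ℝ → E := fun s => T s.toNNReal x
  have hg : Continuous g := (hT.continuous x).comp continuous_real_toNNReal
  have hg' (s : ℝ) (hs : 0 ≤ s) : HasDerivWithinAt g (c • g s) (Ici s) s := by
    -- Since `T r = T s ∘ T (r - s)` for `r > s`, the right difference quotient at `s` is `T s`
    -- applied to the one at `0`. Only right derivatives are available this way, but they suffice to
    -- show that `exp (-c r) • g r` is constant.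
    rw [← hasDerivWithinAt_Ioi_iff_Ici, hasDerivWithinAt_iff_tendsto_slope' (by simp)]
    have h1 : Tendsto (fun r : ℝ => (r - s).toNNReal) (𝓝[>] s) (𝓝[>] 0) := by
      refine tendsto_nhdsWithin_iff.2 ⟨?_, ?_⟩
      · have : Continuous fun r : ℝ => (r - s).toNNReal := by fun_prop
        exact (this.tendsto' s 0 (by simp)).mono_left nhdsWithin_le_nhds
      · filter_upwards [self_mem_nhdsWithin] with r hr
        exact Real.toNNReal_pos.2 (sub_pos.2 hr)
    have h2 := ((T s.toNNReal).continuous.tendsto _).comp (hx.comp h1)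
    rw [map_smul] at h2
    refine h2.congr' ?_
    filter_upwards [self_mem_nhdsWithin] with r hr
    have hr' : 0 ≤ r - s := (sub_pos.2 hr).le
    have e : r.toNNReal = s.toNNReal + (r - s).toNNReal := by
      rw [← Real.toNNReal_add hs hr', add_sub_cancel]
    simp only [Function.comp_apply, slope, vsub_eq_sub, g, e, hT.add, map_smul, map_sub,
      ContinuousLinearMap.comp_apply, Real.coe_toNNReal _ hr']
  have hf (s : ℝ) (hs : s ∈ Ico (0 : ℝ) t) :
      HasDerivWithinAt (fun r => Real.exp (-(c * r)) • g r) 0 (Ici s) s := by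
    have h1 : HasDerivAt (fun r : ℝ => Real.exp (-(c * r))) (Real.exp (-(c * s)) * -c) s := by
      simpa using ((hasDerivAt_id s).const_mul c).neg.exp
    have h2 := h1.hasDerivWithinAt.smul (hg' s hs.1)
    convert! h2 using 1
    module
  have h := constant_of_has_deriv_right_zero
    (f := fun r => Real.exp (-(c * r)) • g r) (by fun_prop) hf t ⟨t.2, le_rfl⟩
  simp only [mul_zero, neg_zero, Real.exp_zero, one_smul, g, Real.toNNReal_coe, Real.toNNReal_zero,
    hT.zero, ContinuousLinearMap.id_apply] at h
  rw [← inv_smul_eq_iff₀ (Real.exp_ne_zero _), ← Real.exp_neg, h]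

end IsC0Semigroup

/-! ### Diagonal semigroups and the abstract generation theorem -/

section Diagonal

variable {ι H : Type*} [NormedAddCommGroup H] [InnerProductSpace ℝ H]
  (φ : HilbertBasis ι ℝ H) {μ : ι → ℝ} {T : ℝ≥0 → H →L[ℝ] H}

theorem HilbertBasis.isC0Semigroup_of_exp (hμ : ∀ i, 0 < μ i)
    (hT : ∀ t i, T t (φ i) = Real.exp (-(μ i)⁻¹ * t) • φ i) : IsC0Semigroup T where
  zero := φ.ext_continuousLinearMap fun i => by simp [hT]
  add s t := φ.ext_continuousLinearMap fun i => by
    simp only [hT, ContinuousLinearMap.comp_apply, map_smul, smul_smul, ← Real.exp_add,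
      NNReal.coe_add]
    ring_nf
  tendsto_zero x := by
    refine φ.tendsto_of_forall_tendsto (S₀ := ContinuousLinearMap.id ℝ H) (fun t => ?_)
      (fun i => ?_) x
    · refine φ.opNorm_le_one_of_diagonal (fun i => ?_) (hT t)
      rw [Real.abs_exp, Real.exp_le_one_iff, neg_mul, neg_nonpos]
      have := (hμ i).le
      positivity
    · simp only [hT, ContinuousLinearMap.id_apply]
      have : Continuous fun t : ℝ≥0 => Real.exp (-(μ i)⁻¹ * t) • φ i := by fun_prop
      exact this.tendsto' _ _ (by simp)

/-- At `x = -K y` the difference quotient is a diagonal operator applied to `y`, with entries `μᵢ (1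
- exp (-t / μᵢ)) / t` in `[0, 1]` that tend to `1`. Conversely, the limit in each coordinate gives
`⟨φᵢ, y⟩ = -μᵢ⁻¹ ⟨φᵢ, x⟩`. -/
theorem HilbertBasis.tendsto_generator_iff (hμ : ∀ i, 0 < μ i)
    (hT : ∀ t i, T t (φ i) = Real.exp (-(μ i)⁻¹ * t) • φ i) {K : H →L[ℝ] H}
    (hK : ∀ i, K (φ i) = μ i • φ i) (x y : H) :
    x = -K y ↔ Tendsto (fun t : ℝ≥0 => (t : ℝ)⁻¹ • (T t x - x)) (𝓝[>] 0) (𝓝 y) := by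
  constructor
  · rintro rfl
    let S : ℝ≥0 → H →L[ℝ] H := fun t =>
      -((t : ℝ)⁻¹ • (T t - ContinuousLinearMap.id ℝ H).comp K)
    have hS (t : ℝ≥0) (i : ι) :
        S t (φ i) = (-(μ i * ((t : ℝ)⁻¹ * (Real.exp (-(μ i)⁻¹ * t) - 1)))) • φ i := by
      simp only [S, _root_.neg_apply, _root_.smul_apply,
        ContinuousLinearMap.comp_apply, _root_.sub_apply, hK, map_smul, hT,
        ContinuousLinearMap.id_apply]
      module
    have h := φ.tendsto_of_forall_tendsto (l := 𝓝[>] 0) (S := S)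
      (S₀ := ContinuousLinearMap.id ℝ H) (fun t => ?_) (fun i => ?_) y
    · refine h.congr fun t => ?_
      simp only [S, _root_.neg_apply, _root_.smul_apply,
        ContinuousLinearMap.comp_apply, _root_.sub_apply, map_neg,
        ContinuousLinearMap.id_apply]
      module
    · refine φ.opNorm_le_one_of_diagonal (fun i => ?_) (hS t)
      have hi := hμ i
      -- The norm bound is required at `t = 0` too, where `0⁻¹ = 0` makes the entry vanish.
      rcases eq_or_lt_of_le t.2 with h0 | h0
      · have h0' : (t : ℝ) = 0 := h0.symm
        simp [h0']
      · have h1 : Real.exp (-(μ i)⁻¹ * t) ≤ 1 := by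
          rw [Real.exp_le_one_iff, neg_mul, neg_nonpos]
          positivity
        have h2 := Real.add_one_le_exp (-(μ i)⁻¹ * t)
        have e : -(μ i * ((t : ℝ)⁻¹ * (Real.exp (-(μ i)⁻¹ * t) - 1)))
            = (μ i * (t : ℝ)⁻¹) * (1 - Real.exp (-(μ i)⁻¹ * t)) := by ring
        have h0' : (0 : ℝ) < t := h0
        rw [e, abs_of_nonneg (mul_nonneg (by positivity) (by linarith))]
        calc (μ i * (t : ℝ)⁻¹) * (1 - Real.exp (-(μ i)⁻¹ * t))
            ≤ (μ i * (t : ℝ)⁻¹) * ((μ i)⁻¹ * t) := by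
              gcongr
              linarith
          _ = 1 := by field_simp
    · simp only [hS, ContinuousLinearMap.id_apply]
      have h := ((tendsto_inv_mul_exp_sub_one (-(μ i)⁻¹)).const_mul (μ i)).neg.smul_const (φ i)
      simpa [(hμ i).ne'] using h
  · intro h
    refine φ.repr.injective (lp.ext (funext fun i => ?_))
    simp only [φ.repr_apply_apply, inner_neg_right, φ.inner_diagonal hK]
    have h1 : Tendsto (fun t : ℝ≥0 => (t : ℝ)⁻¹ * (Real.exp (-(μ i)⁻¹ * t) - 1) *
        inner ℝ (φ i) x) (𝓝[>] 0) (𝓝 (inner ℝ (φ i) y)) := by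
      refine ((innerSL ℝ (φ i)).continuous.tendsto y |>.comp h).congr fun t => ?_
      simp only [Function.comp_apply, innerSL_apply_apply, inner_smul_right, inner_sub_right,
        φ.inner_diagonal (hT t)]
      ring
    have h2 := tendsto_nhds_unique h1
      ((tendsto_inv_mul_exp_sub_one (-(μ i)⁻¹)).mul_const (inner ℝ (φ i) x))
    have := (hμ i).ne'
    rw [h2]
    field_simp

end Diagonal

/-- An operator whose negative inverse is symmetric, positive and Hilbert-Schmidt generates a
unique strongly continuous semigroup, which consists of Hilbert-Schmidt operators. -/
theorem existsUnique_semigroup_of_hilbertSchmidt_inverse {H : Type u} [NormedAddCommGroup H]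
    [InnerProductSpace ℝ H] [CompleteSpace H] {A : H →ₗ.[ℝ] H} {K : H →L[ℝ] H}
    (hsymm : (K : H →ₗ[ℝ] H).IsSymmetric) (hpos : ∀ x, 0 ≤ inner ℝ x (K x))
    (hinj : ∀ x, K x = 0 → x = 0) (hHS : IsHilbertSchmidt K)
    (hA : ∀ x y, (x, y) ∈ A.graph ↔ x = -K y) :
    (∃! T : ℝ≥0 → H →L[ℝ] H, IsC0Semigroup T ∧ IsGeneratorOf A T) ∧
    ∀ T : ℝ≥0 → H →L[ℝ] H, IsC0Semigroup T → IsGeneratorOf A T →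
      ∀ t : ℝ≥0, 0 < t → IsHilbertSchmidt (T t) := by
  obtain ⟨w, e, -⟩ := exists_hilbertBasis ℝ H
  obtain ⟨ι, φ, μ, hμ⟩ := exists_hilbertBasis_eigenvectors
    (isCompactOperator_of_summable_sq e K (hHS _ e)) hsymm
  have hne (i : ι) : φ i ≠ 0 := norm_ne_zero_iff.1 (by simp [φ.orthonormal.1 i])
  have hμpos (i : ι) : 0 < μ i := by
    refine lt_of_le_of_ne ?_ fun h => hne i (hinj _ (by rw [hμ, ← h, zero_smul]))
    simpa [hμ, inner_smul_right, φ.orthonormal.1 i] using hpos (φ i)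
  have hexp (T : ℝ≥0 → H →L[ℝ] H) (hT : IsC0Semigroup T) (hTA : IsGeneratorOf A T)
      (t : ℝ≥0) (i : ι) : T t (φ i) = Real.exp (-(μ i)⁻¹ * t) • φ i := by
    refine hT.apply_eq_exp_smul ((hTA _ _).1 ((hA _ _).2 ?_)) t
    rw [map_smul, hμ, smul_smul, neg_mul, inv_mul_cancel₀ (hμpos i).ne', neg_smul, one_smul,
      neg_neg]
  refine ⟨?_, fun T hT hTA t ht => ?_⟩
  · have hle (t : ℝ≥0) (i : ι) : |Real.exp (-(μ i)⁻¹ * t)| ≤ 1 := by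
      rw [Real.abs_exp, Real.exp_le_one_iff, neg_mul, neg_nonpos]
      have := (hμpos i).le
      positivity
    choose T _ hT using fun t => φ.exists_diagonal (hle t)
    refine ⟨T, ⟨φ.isC0Semigroup_of_exp hμpos hT, fun x y => ?_⟩, fun T' hT' => ?_⟩
    · rw [hA, φ.tendsto_generator_iff hμpos hT hμ]
    · funext t
      exact φ.ext_continuousLinearMap fun i =>
        (hexp T' hT'.1 hT'.2 t i).trans (hT t i).symm
  · refine φ.isHilbertSchmidt_diagonal (hexp T hT hTA t) ?_
    -- From `s ≤ exp s` at `s = t / μᵢ`, the squared entries are dominated by `t⁻² ‖K φᵢ‖² = t⁻²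
    -- μᵢ²`.
    have h := (hHS ι φ).mul_left (((t : ℝ)⁻¹) ^ 2)
    refine h.of_nonneg_of_le (fun _ => sq_nonneg _) fun i => ?_
    have hi := hμpos i
    have ht' : (0 : ℝ) < t := ht
    rw [hμ, norm_smul, φ.orthonormal.1 i, mul_one, Real.norm_eq_abs, abs_of_pos hi, ← mul_pow]
    gcongr
    have h1 : (μ i)⁻¹ * t ≤ Real.exp ((μ i)⁻¹ * t) := by
      linarith [Real.add_one_le_exp ((μ i)⁻¹ * t)]
    rw [neg_mul, Real.exp_neg]
    calc (Real.exp ((μ i)⁻¹ * t))⁻¹ ≤ ((μ i)⁻¹ * t)⁻¹ := by gcongr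
      _ = (t : ℝ)⁻¹ * μ i := by rw [mul_inv, inv_inv, mul_comm]

/-! ### Integration on `L²(0,1)` -/

theorem L2Unit.integrable (f : L2Unit) : Integrable f unitMeasure :=
  (Lp.memLp f).integrable (by norm_num)

theorem L2Unit.intervalIntegrable (f : L2Unit) : IntervalIntegrable f volume 0 1 := by
  rw [intervalIntegrable_iff_integrableOn_Ioo_of_le zero_le_one]
  exact f.integrable

theorem integral_unitMeasure (f : ℝ → ℝ) : ∫ x, f x ∂unitMeasure = ∫ x in 0..1, f x := by
  rw [intervalIntegral.integral_of_le zero_le_one, integral_Ioc_eq_integral_Ioo]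

noncomputable section

/-- The functional `f ↦ ∫ y in 0..x, f y` on `L²(0,1)`. -/
def primitiveEval (x : ℝ) : L2Unit →L[ℝ] ℝ :=
  innerSL ℝ (indicatorConstLp 2 (measurableSet_Ioo : MeasurableSet (Ioo (0 : ℝ) x))
    (measure_ne_top unitMeasure _) (1 : ℝ))

theorem primitiveEval_apply {x : ℝ} (hx : x ∈ Icc (0 : ℝ) 1) (f : L2Unit) :
    primitiveEval x f = ∫ y in 0..x, f y := by
  rw [primitiveEval, innerSL_apply_apply, L2.inner_indicatorConstLp_one,
    Measure.restrict_restrict measurableSet_Ioo, Ioo_inter_Ioo, sup_idem, inf_eq_left.2 hx.2,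
    intervalIntegral.integral_of_le hx.1, integral_Ioc_eq_integral_Ioo]

theorem norm_primitiveEval_le (x : ℝ) : ‖primitiveEval x‖ ≤ 1 := by
  rw [primitiveEval, innerSL_apply_norm, norm_indicatorConstLp (by norm_num) (by norm_num),
    norm_one, one_mul]
  refine Real.rpow_le_one measureReal_nonneg ?_ (by norm_num)
  refine (measureReal_mono (subset_univ _)).trans ?_
  simp [measureReal_def]

theorem primitiveEval_zero (f : L2Unit) : primitiveEval 0 f = 0 := by
  rw [primitiveEval_apply (left_mem_Icc.2 zero_le_one), intervalIntegral.integral_same]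

theorem absolutelyContinuous_primitive (f : L2Unit) :
    AbsolutelyContinuousOnInterval (fun x => ∫ y in 0..x, f y) 0 1 :=
  f.intervalIntegrable.absolutelyContinuousOnInterval_intervalIntegral left_mem_uIcc

theorem continuousOn_primitiveEval (f : L2Unit) :
    ContinuousOn (fun x => primitiveEval x f) (Icc 0 1) := by
  have h := (absolutelyContinuous_primitive f).continuousOn
  rw [uIcc_of_le zero_le_one] at h
  exact h.congr fun x hx => primitiveEval_apply hx f

theorem memLp_primitiveEval (f : L2Unit) : MemLp (fun x => primitiveEval x f) 2 unitMeasure := by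
  refine MemLp.of_bound (((continuousOn_primitiveEval f).mono
    Ioo_subset_Icc_self).aestronglyMeasurable measurableSet_Ioo) ‖f‖
    (Eventually.of_forall fun x => ?_)
  simpa using (primitiveEval x).le_of_opNorm_le (norm_primitiveEval_le x) f

/-- The Volterra operator `f ↦ (x ↦ ∫ y in 0..x, f y)` on `L²(0,1)`. -/
def volterra : L2Unit →L[ℝ] L2Unit :=
  LinearMap.mkContinuous
    { toFun f := (memLp_primitiveEval f).toLp _
      map_add' f g := by
        rw [← MemLp.toLp_add]
        exact MemLp.toLp_congr _ _ (Eventually.of_forall fun x => map_add _ f g)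
      map_smul' c f := by
        rw [RingHom.id_apply, ← MemLp.toLp_const_smul]
        exact MemLp.toLp_congr _ _ (Eventually.of_forall fun x => map_smul _ c f) }
    1 fun f => by
      refine (Lp.norm_le_of_ae_bound (C := ‖f‖) (norm_nonneg f) ?_).trans (le_of_eq ?_)
      · filter_upwards [(memLp_primitiveEval f).coeFn_toLp] with x hx
        rw [LinearMap.coe_mk, AddHom.coe_mk, hx]
        simpa using (primitiveEval x).le_of_opNorm_le (norm_primitiveEval_le x) f
      · simp [measureUnivNNReal]

theorem coeFn_volterra (f : L2Unit) : volterra f =ᵐ[unitMeasure] fun x => primitiveEval x f :=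
  (memLp_primitiveEval f).coeFn_toLp

/-- The constant function `1`. -/
def oneL2 : L2Unit := (memLp_const (1 : ℝ)).toLp _

theorem coeFn_oneL2 : oneL2 =ᵐ[unitMeasure] fun _ => 1 :=
  (memLp_const (1 : ℝ)).coeFn_toLp

/-- The function `x ↦ a + ∫ y in 0..x, f y`. -/
def antideriv (a : ℝ) (f : L2Unit) : L2Unit := a • oneL2 + volterra f

theorem coeFn_antideriv (a : ℝ) (f : L2Unit) :
    antideriv a f =ᵐ[unitMeasure] fun x => a + primitiveEval x f := by
  filter_upwards [Lp.coeFn_add (a • oneL2) (volterra f), Lp.coeFn_smul a oneL2, coeFn_oneL2,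
    coeFn_volterra f] with x h1 h2 h3 h4
  rw [antideriv, h1, Pi.add_apply, h2, Pi.smul_apply, h3, h4, smul_eq_mul, mul_one]

theorem hasBoundaryValues_antideriv (a : ℝ) (f : L2Unit) :
    HasBoundaryValues (antideriv a f) !₂[a, a + primitiveEval 1 f] :=
  ⟨fun x => a + primitiveEval x f, continuousOn_const.add (continuousOn_primitiveEval f),
    coeFn_antideriv a f, by simp [primitiveEval_zero], by simp⟩

theorem HasBoundaryValues.unique {u : L2Unit} {α β : EuclideanSpace ℝ (Fin 2)}
    (hα : HasBoundaryValues u α) (hβ : HasBoundaryValues u β) : α = β := by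
  have h := hα.add (hβ.smul (-1))
  rw [neg_one_smul, neg_one_smul, add_neg_cancel] at h
  exact add_neg_eq_zero.1 h.eq_zero

/-- Integration by parts against an absolutely continuous function. -/
theorem integral_mul_add_antideriv_mul_deriv (a : ℝ) (f : L2Unit) {G : ℝ → ℝ}
    (hG : AbsolutelyContinuousOnInterval G 0 1) :
    ∫ x, f x * G x ∂unitMeasure + ∫ x, antideriv a f x * deriv G x ∂unitMeasure
      = (a + primitiveEval 1 f) * G 1 - a * G 0 := by
  let F : ℝ → ℝ := fun x => a + ∫ y in 0..x, f y
  have hF : AbsolutelyContinuousOnInterval F 0 1 := by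
    have hc : AbsolutelyContinuousOnInterval (fun _ : ℝ => a) 0 1 :=
      contDiff_const.contDiffOn.absolutelyContinuousOnInterval
    exact hc.add (absolutelyContinuous_primitive f)
  have h := hF.integral_deriv_mul_eq_sub hG
  have hF1 : F 1 = a + primitiveEval 1 f := by
    rw [primitiveEval_apply (right_mem_Icc.2 zero_le_one)]
  have hF0 : F 0 = a := by simp [F]
  rw [hF1, hF0] at h
  have hd : ∀ᵐ x ∂unitMeasure, deriv F x = f x := by
    refine (ae_restrict_iff' measurableSet_Ioo).2 ?_
    filter_upwards [f.intervalIntegrable.ae_hasDerivAt_integral] with x hx hx01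
    have hx' : x ∈ uIcc (0 : ℝ) 1 := by
      rw [uIcc_of_le zero_le_one]
      exact Ioo_subset_Icc_self hx01
    exact ((hx hx' 0 left_mem_uIcc).const_add a).deriv
  have hu : ∀ᵐ x ∂unitMeasure, antideriv a f x = F x := by
    filter_upwards [coeFn_antideriv a f, ae_restrict_mem measurableSet_Ioo] with x hx hx01
    rw [hx, primitiveEval_apply (Ioo_subset_Icc_self hx01)]
  have e1 : ∫ x, f x * G x ∂unitMeasure = ∫ x in 0..1, deriv F x * G x := by
    rw [← integral_unitMeasure]
    exact integral_congr_ae (hd.mono fun x hx => by simp only [hx])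
  have e2 : ∫ x, antideriv a f x * deriv G x ∂unitMeasure = ∫ x in 0..1, F x * deriv G x := by
    rw [← integral_unitMeasure]
    exact integral_congr_ae (hu.mono fun x hx => by simp only [hx])
  rw [e1, e2, ← h, intervalIntegral.integral_add]
  · exact hF.intervalIntegrable_deriv.mul_continuousOn hG.continuousOn
  · exact hG.intervalIntegrable_deriv.continuousOn_mul hF.continuousOn

theorem hasWeakDeriv_antideriv (a : ℝ) (f : L2Unit) : HasWeakDeriv (antideriv a f) f := by
  intro φ hφ
  have h := integral_mul_add_antideriv_mul_deriv a f (G := φ)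
    (hφ.1.of_le (by simp)).contDiffOn.absolutelyContinuousOnInterval
  have h0 : φ 0 = 0 := image_eq_zero_of_notMem_tsupport fun h => by simpa using hφ.2.2 h
  have h1 : φ 1 = 0 := image_eq_zero_of_notMem_tsupport fun h => by simpa using hφ.2.2 h
  rw [h0, h1] at h
  linarith

/-- Integration by parts for two antiderivatives; its boundary terms become those of the energy
identity. -/
theorem inner_add_inner_antideriv (a c : ℝ) (f g : L2Unit) :
    inner ℝ f (antideriv a g) + inner ℝ (antideriv c f) g
      = (c + primitiveEval 1 f) * (a + primitiveEval 1 g) - c * a := by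
  let G : ℝ → ℝ := fun x => a + ∫ y in 0..x, g y
  have hG : AbsolutelyContinuousOnInterval G 0 1 := by
    have hc : AbsolutelyContinuousOnInterval (fun _ : ℝ => a) 0 1 :=
      contDiff_const.contDiffOn.absolutelyContinuousOnInterval
    exact hc.add (absolutelyContinuous_primitive g)
  have h := integral_mul_add_antideriv_mul_deriv c f hG
  have hG1 : G 1 = a + primitiveEval 1 g := by
    rw [primitiveEval_apply (right_mem_Icc.2 zero_le_one)]
  have hG0 : G 0 = a := by simp [G]
  rw [hG1, hG0] at h
  rw [← h, L2.inner_def, L2.inner_def]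
  congr 1
  · refine integral_congr_ae ?_
    filter_upwards [coeFn_antideriv a g, ae_restrict_mem measurableSet_Ioo] with x hx hx01
    rw [hx, primitiveEval_apply (Ioo_subset_Icc_self hx01)]
    simp [G, mul_comm]
  · refine integral_congr_ae ((ae_restrict_iff' measurableSet_Ioo).2 ?_)
    filter_upwards [g.intervalIntegrable.ae_hasDerivAt_integral] with x hx hx01
    have hx' : x ∈ uIcc (0 : ℝ) 1 := by
      rw [uIcc_of_le zero_le_one]
      exact Ioo_subset_Icc_self hx01
    have : deriv G x = g x := ((hx hx' 0 left_mem_uIcc).const_add a).deriv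
    simp [this, mul_comm]

/-! ### Weak derivatives and antiderivatives -/

/-- A test function of integral zero is the derivative of a test function. -/
theorem IsTestFunction.exists_deriv_eq {θ : ℝ → ℝ} (hθ : IsTestFunction θ)
    (h0 : ∫ x in 0..1, θ x = 0) : ∃ Θ : ℝ → ℝ, IsTestFunction Θ ∧ deriv Θ = θ := by
  let Θ : ℝ → ℝ := fun x => ∫ y in 0..x, θ y
  have hc : Continuous θ := hθ.1.continuous
  have hd (x : ℝ) : HasDerivAt Θ (θ x) x := (hc.integral_hasStrictDerivAt 0 x).hasDerivAt
  have hder : deriv Θ = θ := funext fun x => (hd x).deriv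
  obtain ⟨α, β, hα, hβ, hs⟩ : ∃ α β : ℝ, 0 < α ∧ β < 1 ∧ tsupport θ ⊆ Icc α β := by
    rcases (tsupport θ).eq_empty_or_nonempty with he | hne
    · exact ⟨1 / 2, 1 / 2, by norm_num, by norm_num, by simp [he]⟩
    · obtain ⟨α, hα⟩ := hθ.2.1.isCompact.exists_isLeast hne
      obtain ⟨β, hβ⟩ := hθ.2.1.isCompact.exists_isGreatest hne
      exact ⟨α, β, (hθ.2.2 hα.1).1, (hθ.2.2 hβ.1).2, fun x hx => ⟨hα.2 hx, hβ.2 hx⟩⟩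
  have hz (x : ℝ) (hx : x ∉ Icc α β) : θ x = 0 :=
    image_eq_zero_of_notMem_tsupport fun h => hx (hs h)
  have hsupp : Function.support Θ ⊆ Icc α β := by
    intro x hx
    by_contra hxn
    refine hx ?_
    rw [mem_Icc, not_and_or, not_le, not_le] at hxn
    rcases hxn with hxα | hxβ
    · refine (intervalIntegral.integral_congr (g := fun _ => 0) fun y hy => ?_).trans (by simp)
      refine hz y fun hy' => ?_
      have := (mem_uIcc.1 hy)
      rcases this with h | h <;> linarith [hy'.1, h.1, h.2]
    -- To the right of the support, the primitive equals the total integral, which is zero.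
    · have h1 : ∫ y in 1..x, θ y = 0 := by
        refine (intervalIntegral.integral_congr (g := fun _ => 0) fun y hy => ?_).trans (by simp)
        refine hz y fun hy' => ?_
        rcases mem_uIcc.1 hy with h | h <;> linarith [hy'.2, h.1, h.2]
      have := intervalIntegral.integral_add_adjacent_intervals (hc.intervalIntegrable 0 1)
        (hc.intervalIntegrable 1 x) (μ := volume)
      rw [h0, h1, add_zero] at this
      exact this.symm
  have hts : tsupport Θ ⊆ Icc α β := closure_minimal hsupp isClosed_Icc
  refine ⟨Θ, ⟨?_, ?_, ?_⟩, hder⟩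
  · exact contDiff_infty_iff_deriv.2 ⟨fun x => (hd x).differentiableAt, by rw [hder]; exact hθ.1⟩
  · exact isCompact_Icc.of_isClosed_subset (isClosed_tsupport _) hts
  · exact hts.trans fun x hx => ⟨hα.trans_le hx.1, hx.2.trans_lt hβ⟩

theorem exists_isTestFunction_integral_eq_one :
    ∃ ψ : ℝ → ℝ, IsTestFunction ψ ∧ ∫ x in 0..1, ψ x = 1 := by
  let b : ContDiffBump (1 / 2 : ℝ) := ⟨1 / 8, 1 / 4, by norm_num, by norm_num⟩
  have hs : tsupport (b.normed volume) ⊆ Ioo (0 : ℝ) 1 := by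
    rw [b.tsupport_normed_eq, Real.closedBall_eq_Icc]
    intro x hx
    norm_num [b] at hx
    constructor <;> linarith [hx.1, hx.2]
  refine ⟨b.normed volume, ⟨b.contDiff_normed, b.hasCompactSupport_normed, hs⟩, ?_⟩
  rw [← integral_unitMeasure, setIntegral_eq_integral_of_forall_compl_eq_zero, b.integral_normed]
  intro x hx
  exact image_eq_zero_of_notMem_tsupport fun h => hx (hs h)

/-- Du Bois-Reymond: for a test function `ψ` of integral one, `φ - (∫ φ) ψ` is the derivative of a
test function, so `∫ u φ = (∫ u ψ) (∫ φ)` for every test function `φ`. -/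
theorem HasWeakDeriv.eq_smul_oneL2 {u : L2Unit} (hu : HasWeakDeriv u 0) :
    ∃ a : ℝ, u = a • oneL2 := by
  obtain ⟨ψ, hψ, hψ1⟩ := exists_isTestFunction_integral_eq_one
  refine ⟨∫ x, u x * ψ x ∂unitMeasure, ?_⟩
  set a := ∫ x, u x * ψ x ∂unitMeasure
  refine sub_eq_zero.1 (HasWeakDeriv.eq_zero fun φ hφ => ?_)
  have hφi : IntervalIntegrable φ volume 0 1 := hφ.1.continuous.intervalIntegrable _ _
  have hψi : IntervalIntegrable ψ volume 0 1 := hψ.1.continuous.intervalIntegrable _ _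
  set m := ∫ x in 0..1, φ x with hm
  have hθ : IsTestFunction fun x => φ x - m * ψ x := by
    refine ⟨hφ.1.sub (contDiff_const.mul hψ.1), hφ.2.1.sub hψ.2.1.mul_left, ?_⟩
    refine (tsupport_sub φ fun x => m * ψ x).trans (union_subset hφ.2.2 ?_)
    exact (tsupport_mul_subset_right (f := fun _ => m)).trans hψ.2.2
  obtain ⟨Θ, hΘ, hΘd⟩ := hθ.exists_deriv_eq (by
    rw [intervalIntegral.integral_sub hφi (hψi.const_mul m), intervalIntegral.integral_const_mul,
      hψ1, ← hm, mul_one, sub_self])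
  have e0 (χ : ℝ → ℝ) : ∫ x, (0 : L2Unit) x * χ x ∂unitMeasure = 0 := by
    refine (integral_congr_ae ?_).trans (integral_zero ℝ ℝ)
    filter_upwards [Lp.coeFn_zero ℝ 2 unitMeasure] with x hx
    rw [hx, Pi.zero_apply, zero_mul]
  have h := hu Θ hΘ
  rw [hΘd, e0, neg_zero] at h
  have h1 : ∫ x, u x * (φ x - m * ψ x) ∂unitMeasure = ∫ x, u x * φ x ∂unitMeasure - m * a := by
    rw [← integral_const_mul, ← integral_sub (hφ.integrable_mul u)
      ((hψ.integrable_mul u).const_mul m)]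
    exact integral_congr_ae (Eventually.of_forall fun x => by ring)
  have h2 : ∫ x, (u - a • oneL2 : L2Unit) x * φ x ∂unitMeasure
      = ∫ x, u x * φ x ∂unitMeasure - a * m := by
    rw [hm, ← integral_unitMeasure, ← integral_const_mul, ← integral_sub (hφ.integrable_mul u)]
    · refine integral_congr_ae ?_
      filter_upwards [Lp.coeFn_sub u (a • oneL2), Lp.coeFn_smul a oneL2, coeFn_oneL2]
        with x k1 k2 k3
      rw [k1, Pi.sub_apply, k2, Pi.smul_apply, k3, smul_eq_mul]
      ring
    · exact (hφ.1.continuous.integrable_of_hasCompactSupport hφ.2.1).restrict.const_mul a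
  rw [e0, h2]
  linarith

theorem HasWeakDeriv.exists_eq_antideriv {u g : L2Unit} (hu : HasWeakDeriv u g) :
    ∃ a : ℝ, u = antideriv a g := by
  have h := hu.add ((hasWeakDeriv_antideriv 0 g).smul (-1))
  rw [neg_one_smul, neg_one_smul, add_neg_cancel] at h
  obtain ⟨a, ha⟩ := h.eq_smul_oneL2
  refine ⟨a, ?_⟩
  rw [antideriv, ← ha, antideriv]
  simp

end

/-! ### The explicit inverse of the matrix operator -/

/-- `𝔸 U = W` holds exactly if the function in `U` is obtained by integrating the one in `W` twice,
with initial values that match the boundary conditions. -/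
theorem mem_matrixOpGraph_iff (b₀ b₁ : ℝ) (U W : StateSpace) :
    (U, W) ∈ matrixOpGraph b₀ b₁ ↔ ∃ a c : ℝ,
      U.fst = antideriv a (antideriv c W.fst) ∧
      U.snd = !₂[a, a + primitiveEval 1 (antideriv c W.fst)] ∧
      W.snd 0 = c - b₀ * a ∧
      W.snd 1 = -(c + primitiveEval 1 W.fst)
        - b₁ * (a + primitiveEval 1 (antideriv c W.fst)) := by
  constructor
  · rintro ⟨hU, g, γ, h1, h2, h3, h4, h5⟩
    dsimp only at hU h1 h2 h4 h5
    obtain ⟨a, ha⟩ := h1.exists_eq_antideriv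
    obtain ⟨c, rfl⟩ := h2.exists_eq_antideriv
    have hγ := h3.unique (hasBoundaryValues_antideriv c W.fst)
    have hv := hU.unique (ha ▸ hasBoundaryValues_antideriv a (antideriv c W.fst))
    refine ⟨a, c, ha, hv, ?_, ?_⟩
    · rw [h4, hγ, hv]
      simp
      ring
    · rw [h5, hγ, hv]
      simp
      ring
  · rintro ⟨a, c, h1, h2, h3, h4⟩
    refine ⟨?_, antideriv c W.fst, !₂[c, c + primitiveEval 1 W.fst], ?_, hasWeakDeriv_antideriv _ _,
      hasBoundaryValues_antideriv _ _, ?_, ?_⟩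
    · change HasBoundaryValues U.fst U.snd
      rw [h1, h2]
      exact hasBoundaryValues_antideriv _ _
    · change HasWeakDeriv U.fst _
      rw [h1]
      exact hasWeakDeriv_antideriv _ _
    · change W.snd 0 = _ + _ * U.snd 0
      rw [h3, h2]
      simp
      ring
    · change W.snd 1 = _ + _ * U.snd 1
      rw [h4, h2]
      simp
      ring

theorem primitiveEval_one_oneL2 : primitiveEval 1 oneL2 = 1 := by
  rw [primitiveEval_apply (right_mem_Icc.2 zero_le_one), ← integral_unitMeasure,
    integral_congr_ae coeFn_oneL2]
  simp

theorem primitiveEval_one_antideriv (c : ℝ) (f : L2Unit) :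
    primitiveEval 1 (antideriv c f) = c + primitiveEval 1 (volterra f) := by
  rw [antideriv, map_add, map_smul, primitiveEval_one_oneL2, smul_eq_mul, mul_one]

/-- Bessel's inequality for the Riesz representative of `ℓ`. -/
theorem sum_sq_apply_le {H : Type*} [NormedAddCommGroup H] [InnerProductSpace ℝ H]
    [CompleteSpace H] (ℓ : H →L[ℝ] ℝ) {ι : Type*} {φ : ι → H} (hφ : Orthonormal ℝ φ)
    (s : Finset ι) : ∑ i ∈ s, ℓ (φ i) ^ 2 ≤ ‖ℓ‖ ^ 2 := by
  obtain ⟨z, rfl⟩ := (InnerProductSpace.toDual ℝ H).surjective ℓ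
  have h := hφ.sum_inner_products_le (s := s) z
  rw [LinearIsometryEquiv.norm_map]
  refine le_trans (le_of_eq (Finset.sum_congr rfl fun i _ => ?_)) h
  rw [InnerProductSpace.toDual_apply_apply, real_inner_comm, Real.norm_eq_abs, sq_abs]

noncomputable section

/-- Square summability, with a uniform bound, of the images of an orthonormal family under an
operator into `L²(0,1)` with uniformly bounded point evaluations. -/
theorem sum_sq_norm_le_of_eval {H : Type*} [NormedAddCommGroup H] [InnerProductSpace ℝ H]
    [CompleteSpace H] (P : H →L[ℝ] L2Unit) (ℓ : ℝ → H →L[ℝ] ℝ) {C : ℝ}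
    (hℓ : ∀ x, ‖ℓ x‖ ≤ C) (h : ∀ z, P z =ᵐ[unitMeasure] fun x => ℓ x z)
    {ι : Type*} {φ : ι → H} (hφ : Orthonormal ℝ φ) (s : Finset ι) :
    ∑ i ∈ s, ‖P (φ i)‖ ^ 2 ≤ C ^ 2 := by
  have hsq (i : ι) : Integrable (fun x => P (φ i) x ^ 2) unitMeasure :=
    (Lp.memLp (P (φ i))).integrable_sq
  have e (i : ι) : ‖P (φ i)‖ ^ 2 = ∫ x, P (φ i) x ^ 2 ∂unitMeasure := by
    rw [← real_inner_self_eq_norm_sq, L2.inner_def]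
    exact integral_congr_ae (Eventually.of_forall fun x => by simp [sq])
  -- Each identity `P z = ℓ x z` has its own null set; finiteness of `s` allows a common one.
  have hae : ∀ᵐ x ∂unitMeasure, ∀ i ∈ s, P (φ i) x = ℓ x (φ i) :=
    (ae_ball_iff s.countable_toSet).2 fun i _ => h (φ i)
  calc ∑ i ∈ s, ‖P (φ i)‖ ^ 2 = ∫ x, ∑ i ∈ s, P (φ i) x ^ 2 ∂unitMeasure := by
        rw [integral_finsetSum _ fun i _ => hsq i]
        exact Finset.sum_congr rfl fun i _ => e i
    _ ≤ ∫ _, C ^ 2 ∂unitMeasure := by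
        refine integral_mono_ae (integrable_finsetSum _ fun i _ => hsq i) (integrable_const _) ?_
        filter_upwards [hae] with x hx
        have hb : ∑ i ∈ s, ℓ x (φ i) ^ 2 ≤ ‖ℓ x‖ ^ 2 := sum_sq_apply_le (ℓ x) hφ s
        calc ∑ i ∈ s, P (φ i) x ^ 2 = ∑ i ∈ s, ℓ x (φ i) ^ 2 :=
              Finset.sum_congr rfl fun i hi => by rw [hx i hi]
          _ ≤ ‖ℓ x‖ ^ 2 := hb
          _ ≤ C ^ 2 := by gcongr; exact hℓ x
    _ = C ^ 2 := by simp

/-- The `i`-th boundary component of a state. -/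
def boundaryCoord (i : Fin 2) : StateSpace →L[ℝ] ℝ :=
  (EuclideanSpace.proj i).comp (WithLp.sndL 2 ℝ L2Unit (EuclideanSpace ℝ (Fin 2)))

/-- The value `u(0)` of the solution `(u, v)` of `𝔸 (u, v) = W`. -/
def solutionLeft (b₀ b₁ : ℝ) : StateSpace →L[ℝ] ℝ :=
  -- Eliminating `c = W.snd 0 + b₀ a` from the boundary equation at `1` leaves a linear equation for
  -- `a = u(0)` with coefficient `b₁ + b₀ (1 + b₁)`.
  (-(b₁ + b₀ * (1 + b₁))⁻¹) • (boundaryCoord 1 + (1 + b₁) • boundaryCoord 0 +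
    (primitiveEval 1 + b₁ • (primitiveEval 1).comp volterra).comp
      (WithLp.fstL 2 ℝ L2Unit (EuclideanSpace ℝ (Fin 2))))

theorem solutionLeft_apply (b₀ b₁ : ℝ) (W : StateSpace) :
    solutionLeft b₀ b₁ W = -(b₁ + b₀ * (1 + b₁))⁻¹ * (W.snd 1 + (1 + b₁) * W.snd 0 +
      (primitiveEval 1 W.fst + b₁ * primitiveEval 1 (volterra W.fst))) := rfl

/-- The slope `u'(0)` of the solution `(u, v)` of `𝔸 (u, v) = W`. -/
def solutionSlope (b₀ b₁ : ℝ) : StateSpace →L[ℝ] ℝ :=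
  boundaryCoord 0 + b₀ • solutionLeft b₀ b₁

theorem solutionSlope_apply (b₀ b₁ : ℝ) (W : StateSpace) :
    solutionSlope b₀ b₁ W = W.snd 0 + b₀ * solutionLeft b₀ b₁ W := rfl

/-- The derivative `u'` of the solution `(u, v)` of `𝔸 (u, v) = W`. -/
def solutionDeriv (b₀ b₁ : ℝ) : StateSpace →L[ℝ] L2Unit :=
  (solutionSlope b₀ b₁).smulRight oneL2 +
    volterra.comp (WithLp.fstL 2 ℝ L2Unit (EuclideanSpace ℝ (Fin 2)))

theorem solutionDeriv_apply (b₀ b₁ : ℝ) (W : StateSpace) :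
    solutionDeriv b₀ b₁ W = antideriv (solutionSlope b₀ b₁ W) W.fst := rfl

/-- The value `u(x)` of the solution `(u, v)` of `𝔸 (u, v) = W`. -/
def solutionEval (b₀ b₁ x : ℝ) : StateSpace →L[ℝ] ℝ :=
  solutionLeft b₀ b₁ + (primitiveEval x).comp (solutionDeriv b₀ b₁)

theorem solutionEval_apply (b₀ b₁ x : ℝ) (W : StateSpace) :
    solutionEval b₀ b₁ x W = solutionLeft b₀ b₁ W +
      primitiveEval x (antideriv (solutionSlope b₀ b₁ W) W.fst) := rfl

theorem norm_solutionEval_le (b₀ b₁ x : ℝ) :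
    ‖solutionEval b₀ b₁ x‖ ≤ ‖solutionLeft b₀ b₁‖ + ‖solutionDeriv b₀ b₁‖ := by
  refine (norm_add_le _ _).trans (add_le_add_right ?_ _)
  refine (ContinuousLinearMap.opNorm_comp_le _ _).trans ?_
  exact mul_le_of_le_one_left (norm_nonneg _) (norm_primitiveEval_le x)

/-- The function `u` in the solution `(u, v)` of `𝔸 (u, v) = W`. -/
def solutionFun (b₀ b₁ : ℝ) : StateSpace →L[ℝ] L2Unit :=
  (solutionLeft b₀ b₁).smulRight oneL2 + volterra.comp (solutionDeriv b₀ b₁)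

/-- The bounded inverse of `-𝔸`. -/
def negInverse (b₀ b₁ : ℝ) : StateSpace →L[ℝ] StateSpace :=
  -((WithLp.prodContinuousLinearEquiv 2 ℝ L2Unit (EuclideanSpace ℝ (Fin 2))).symm :
      L2Unit × EuclideanSpace ℝ (Fin 2) →L[ℝ] StateSpace).comp
    ((solutionFun b₀ b₁).prod ((solutionLeft b₀ b₁).smulRight !₂[1, 0] +
      (solutionEval b₀ b₁ 1).smulRight !₂[0, 1]))

theorem negInverse_fst (b₀ b₁ : ℝ) (W : StateSpace) :
    (negInverse b₀ b₁ W).fst = -solutionFun b₀ b₁ W := rfl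

theorem negInverse_snd (b₀ b₁ : ℝ) (W : StateSpace) :
    (negInverse b₀ b₁ W).snd = -!₂[solutionLeft b₀ b₁ W, solutionEval b₀ b₁ 1 W] := by
  have h : (negInverse b₀ b₁ W).snd = -(solutionLeft b₀ b₁ W • !₂[(1 : ℝ), 0] +
    solutionEval b₀ b₁ 1 W • !₂[0, 1]) := rfl
  rw [h]
  ext i
  fin_cases i <;> simp

theorem mem_matrixOp_graph_iff {b₀ b₁ : ℝ} (hb₀ : 0 < b₀) (hb₁ : 0 < b₁) (U W : StateSpace) :
    (U, W) ∈ (matrixOp b₀ b₁).graph ↔ U = -negInverse b₀ b₁ W := by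
  have hD : b₁ + b₀ * (1 + b₁) ≠ 0 := by positivity
  have hU : U = -negInverse b₀ b₁ W ↔
      U.fst = solutionFun b₀ b₁ W ∧
        U.snd = !₂[solutionLeft b₀ b₁ W, solutionEval b₀ b₁ 1 W] := by
    constructor
    · rintro rfl
      rw [WithLp.neg_fst, WithLp.neg_snd, negInverse_fst, negInverse_snd, neg_neg, neg_neg]
      exact ⟨rfl, rfl⟩
    · rintro ⟨h1, h2⟩
      refine WithLp.ofLp_injective 2 (Prod.ext ?_ ?_)
      · exact h1.trans (neg_neg _).symm
      · refine h2.trans ?_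
        rw [← neg_neg !₂[solutionLeft b₀ b₁ W, solutionEval b₀ b₁ 1 W], ← negInverse_snd]
        rfl
  rw [matrixOp_graph, mem_matrixOpGraph_iff, hU]
  constructor
  · rintro ⟨a, c, h1, h2, h3, h4⟩
    have ha : a = solutionLeft b₀ b₁ W := by
      rw [solutionLeft_apply, neg_mul, eq_neg_iff_add_eq_zero]
      rw [primitiveEval_one_antideriv] at h4
      field_simp
      rw [h4, h3]
      ring
    have hc : c = solutionSlope b₀ b₁ W := by
      rw [solutionSlope_apply, h3, ha]
      ring
    subst ha hc
    exact ⟨h1, h2⟩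
  · rintro ⟨h1, h2⟩
    refine ⟨solutionLeft b₀ b₁ W, solutionSlope b₀ b₁ W, h1, h2, ?_, ?_⟩
    · rw [solutionSlope_apply]
      ring
    · rw [primitiveEval_one_antideriv, solutionSlope_apply, solutionLeft_apply]
      field_simp
      ring

/-- The energy identity. -/
theorem inner_negInverse (b₀ b₁ : ℝ) (hb₀ : 0 < b₀) (hb₁ : 0 < b₁) (W Z : StateSpace) :
    inner ℝ W (negInverse b₀ b₁ Z) =
      inner ℝ (solutionDeriv b₀ b₁ W) (solutionDeriv b₀ b₁ Z) +
        b₀ * (solutionLeft b₀ b₁ W * solutionLeft b₀ b₁ Z) +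
        b₁ * (solutionEval b₀ b₁ 1 W * solutionEval b₀ b₁ 1 Z) := by
  -- The boundary equations express `W.snd` through `u_W(0)`, `u_W(1)`, `u_W'(0)` and `u_W'(1)`; the
  -- terms with `u_W'` then cancel the boundary terms of the integration by parts `hp`.
  obtain ⟨h0, h1⟩ : W.snd 0 = solutionSlope b₀ b₁ W - b₀ * solutionLeft b₀ b₁ W ∧
      W.snd 1 = -(solutionSlope b₀ b₁ W + primitiveEval 1 W.fst) -
        b₁ * solutionEval b₀ b₁ 1 W := by
    have hD : b₁ + b₀ * (1 + b₁) ≠ 0 := by positivity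
    rw [solutionEval_apply, primitiveEval_one_antideriv, solutionSlope_apply, solutionLeft_apply]
    constructor
    · ring
    · field_simp
      ring
  have hp := inner_add_inner_antideriv (solutionLeft b₀ b₁ Z) (solutionSlope b₀ b₁ W) W.fst
    (solutionDeriv b₀ b₁ Z)
  have e : inner ℝ W (negInverse b₀ b₁ Z) = -inner ℝ W.fst (solutionFun b₀ b₁ Z) -
      (W.snd 0 * solutionLeft b₀ b₁ Z + W.snd 1 * solutionEval b₀ b₁ 1 Z) := by
    have : inner ℝ W (negInverse b₀ b₁ Z) = inner ℝ W.fst (negInverse b₀ b₁ Z).fst +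
      inner ℝ W.snd (negInverse b₀ b₁ Z).snd := rfl
    rw [this, negInverse_fst, negInverse_snd, inner_neg_right, inner_neg_right, sub_eq_add_neg]
    congr 2
    rw [PiLp.inner_apply, Fin.sum_univ_two]
    simp [mul_comm]
  have hf : solutionFun b₀ b₁ Z = antideriv (solutionLeft b₀ b₁ Z) (solutionDeriv b₀ b₁ Z) := rfl
  have hz : solutionEval b₀ b₁ 1 Z =
    solutionLeft b₀ b₁ Z + primitiveEval 1 (solutionDeriv b₀ b₁ Z) := rfl
  rw [← hf, ← hz, ← solutionDeriv_apply] at hp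
  rw [e, h0, h1]
  linear_combination -hp

/-- The function component has uniformly bounded evaluations, and the boundary component consists of
two bounded functionals, to which Bessel applies. -/
theorem isHilbertSchmidt_negInverse (b₀ b₁ : ℝ) : IsHilbertSchmidt (negInverse b₀ b₁) := by
  intro ι φ
  have h (s : Finset ι) := sum_sq_norm_le_of_eval (solutionFun b₀ b₁) (solutionEval b₀ b₁)
    (norm_solutionEval_le b₀ b₁) (fun W => coeFn_antideriv _ _) φ.orthonormal s
  refine summable_of_sum_le (c := (‖solutionLeft b₀ b₁‖ + ‖solutionDeriv b₀ b₁‖) ^ 2 +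
    (‖solutionLeft b₀ b₁‖ ^ 2 + ‖solutionEval b₀ b₁ 1‖ ^ 2)) (fun _ => sq_nonneg _) fun s => ?_
  have e (i : ι) : ‖negInverse b₀ b₁ (φ i)‖ ^ 2 = ‖solutionFun b₀ b₁ (φ i)‖ ^ 2 +
      (solutionLeft b₀ b₁ (φ i) ^ 2 + solutionEval b₀ b₁ 1 (φ i) ^ 2) := by
    rw [WithLp.prod_norm_sq_eq_of_L2, negInverse_fst, negInverse_snd, norm_neg, norm_neg,
      EuclideanSpace.norm_sq_eq, Fin.sum_univ_two]
    simp
  simp only [e, Finset.sum_add_distrib]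
  exact add_le_add (h s) (add_le_add (sum_sq_apply_le _ φ.orthonormal s)
    (sum_sq_apply_le _ φ.orthonormal s))

end

theorem mainTheorem4 (b₀ b₁ : ℝ) (hb₀ : 0 < b₀) (hb₁ : 0 < b₁) :
    (∃! T : ℝ≥0 → StateSpace →L[ℝ] StateSpace,
      IsC0Semigroup T ∧ IsGeneratorOf (matrixOp b₀ b₁) T) ∧
    ∀ T : ℝ≥0 → StateSpace →L[ℝ] StateSpace,
      IsC0Semigroup T → IsGeneratorOf (matrixOp b₀ b₁) T →
        ∀ t : ℝ≥0, 0 < t → IsHilbertSchmidt (T t) := by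
  have hA := mem_matrixOp_graph_iff hb₀ hb₁
  refine existsUnique_semigroup_of_hilbertSchmidt_inverse (K := negInverse b₀ b₁)
    (fun W Z => ?_) (fun W => ?_) (fun W hW => ?_) (isHilbertSchmidt_negInverse b₀ b₁) hA
  · change inner ℝ (negInverse b₀ b₁ W) Z = inner ℝ W (negInverse b₀ b₁ Z)
    rw [real_inner_comm, inner_negInverse b₀ b₁ hb₀ hb₁, inner_negInverse b₀ b₁ hb₀ hb₁,
      real_inner_comm]
    ring
  · rw [inner_negInverse b₀ b₁ hb₀ hb₁, real_inner_self_eq_norm_sq]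
    have h1 := mul_nonneg hb₀.le (mul_self_nonneg (solutionLeft b₀ b₁ W))
    have h2 := mul_nonneg hb₁.le (mul_self_nonneg (solutionEval b₀ b₁ 1 W))
    positivity
  -- If `K W = 0`, then `(0, W)` lies in the graph of `𝔸`, which is single-valued.
  · have h0 : ((0 : StateSpace), W) ∈ matrixOpGraph b₀ b₁ := by
      rw [← matrixOp_graph, hA, hW, neg_zero]
    exact matrixOpGraph_single_valued b₀ b₁ _ h0 rfl
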